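/- **Proposition.** For Young diagrams $\alpha,\beta,\gamma$ let $N_{\alpha,\beta}^{\gamma}\in\mathbb{N}$ be the Littlewood–Richardson coefficients, defined by $s_\alpha s_\beta=\sum_\gamma N_{\alpha,\beta}^{\gamma}s_\gamma$, where $s_\lambda$ is the Schur function of $\lambda$. For integers $n\ge 1$ and $0\le r\le n-1$ let $\eta_{n,r}=(n-r,\underbrace{1,\ldots,1}_{r})$ be the corresponding hook. Let $|\lambda|$ be the number of boxes of $\lambda$. For Young diagrams $\alpha$ and $\beta$ let $\beta/\alpha$ be the set of boxes of $\beta$ that are not in $\alpha$, let $k(\beta/\alpha)$ be its number of connected components (two boxes being adjacent when they share an edge), and let $v(\beta/\alpha)$ be the number of boxes of $\beta/\alpha$ such that the box immediately above also belongs to $\beta/\alpha$ (the number of vertical dominoes in $\beta/\alpha$). Let $\alpha$ and $\beta$ be two Young diagrams, and let $n\ge 1$ and $0\le r\le n-1$. Then $N_{\alpha,\eta_{n,r}}^{\beta}\neq 0$ if and only if the following conditions all hold: $\alpha\subset\beta$; $|\beta|=|\alpha|+n$; $\beta/\alpha$ contains no $2\times 2$ square of boxes; and $v(\beta/\alpha)\le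 r\le v(\beta/\alpha)+k(\beta/\alpha)-1$. In this case $$N_{\alpha,\eta_{n,r}}^{\beta}=\binom{k(\beta/\alpha)-1}{r-v(\beta/\alpha)}.$$ -/

import Mathlib

namespace SchurHook

/-- The alternant `det (x_j ^ (μ_i + N - 1 - i))` in the variables `x_0, …, x_{N-1}`
(rows and columns numbered from `0`). -/
noncomputable def alternant (N : ℕ) (μ : YoungDiagram) : MvPolynomial (Fin N) ℤ :=
  Matrix.det (Matrix.of fun i j : Fin N =>
    (MvPolynomial.X j : MvPolynomial (Fin N) ℤ) ^ (μ.rowLen i + (N - 1 - i)))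

/-- The Schur function of `μ` in `N` variables: the ratio of alternants
`det (x_j ^ (μ_i + N - 1 - i)) / det (x_j ^ (N - 1 - i))` if `μ` has at most `N` rows
(`μ.colLen 0` is the number of rows), and `0` otherwise.  The ratio is formed
in the field of fractions of the polynomial ring. -/
noncomputable def schur (N : ℕ) (μ : YoungDiagram) : FractionRing (MvPolynomial (Fin N) ℤ) :=
  if μ.colLen 0 ≤ N then
    algebraMap (MvPolynomial (Fin N) ℤ) _ (alternant N μ) /
      algebraMap (MvPolynomial (Fin N) ℤ) _ (alternant N ⊥)
  else 0

/-- `c` is the family of coefficients in the expansion `s_α s_β = ∑_γ c γ s_γ`, as an identity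
between symmetric functions, that is, in every number of variables. -/
def IsSchurExpansion (α β : YoungDiagram) (c : YoungDiagram →₀ ℕ) : Prop :=
  ∀ N : ℕ, schur N α * schur N β = ∑ γ ∈ c.support, (c γ : FractionRing _) * schur N γ

open Classical in
/-- The only monomial of the alternant of `μ` whose exponents decrease strictly is the diagonal
one. -/
theorem coeff_alternant (N : ℕ) (μ ν : YoungDiagram) (hμ : μ.colLen 0 ≤ N)
    (hν : ν.colLen 0 ≤ N) :
    (alternant N μ).coeff
      (Finsupp.equivFunOnFinite.symm fun i : Fin N => ν.rowLen i + (N - 1 - i)) =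
        if μ = ν then 1 else 0 := by
  have anti : ∀ κ : YoungDiagram, StrictAnti fun i : Fin N => κ.rowLen i + (N - 1 - (i : ℕ)) := by
    intro κ i j hij
    have h1 := κ.rowLen_anti i j (le_of_lt hij)
    have h2 : (i : ℕ) < j := hij
    have h3 := j.2
    simp only
    omega
  have key : ∀ σ : Equiv.Perm (Fin N),
      (MvPolynomial.coeff
        (Finsupp.equivFunOnFinite.symm fun i : Fin N => ν.rowLen i + (N - 1 - i))
        (∏ i : Fin N, (MvPolynomial.X i : MvPolynomial (Fin N) ℤ) ^
          (μ.rowLen (σ i) + (N - 1 - (σ i : ℕ))))) = if σ = 1 ∧ μ = ν then 1 else 0 := by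
    intro σ
    rw [MvPolynomial.coeff_prod_X_pow]
    congr 1
    rw [eq_iff_iff]
    constructor
    · intro h
      have h0 : (fun i : Fin N => ν.rowLen i + (N - 1 - (i : ℕ))) =
          (fun i : Fin N => μ.rowLen i + (N - 1 - (i : ℕ))) ∘ σ := by
        funext i
        have := DFunLike.congr_fun h i
        simpa [Finsupp.indicator_apply] using this
      have h1 : (fun i : Fin N => ν.rowLen i + (N - 1 - (i : ℕ))) =
          (fun i : Fin N => μ.rowLen i + (N - 1 - (i : ℕ))) := by
        refine Set.range_injOn_strictAnti (anti ν) (anti μ) ?_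
        rw [h0, σ.surjective.range_comp]
      have hσ : σ = 1 := by
        ext1 i
        have := congrFun (h1.symm.trans h0) i
        exact ((anti μ).injective this).symm
      refine ⟨hσ, ?_⟩
      have hrow : ∀ i, μ.rowLen i = ν.rowLen i := by
        intro i
        by_cases hi : i < N
        · have := congrFun h1 ⟨i, hi⟩
          simp only at this
          omega
        · have z : ∀ κ : YoungDiagram, κ.colLen 0 ≤ N → κ.rowLen i = 0 := by
            intro κ hκ
            by_contra hne
            have : (i, 0) ∈ κ := YoungDiagram.mem_iff_lt_rowLen.2 (Nat.pos_of_ne_zero hne)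
            have := YoungDiagram.mem_iff_lt_colLen.1 this
            omega
          rw [z μ hμ, z ν hν]
      ext ⟨i, j⟩
      rw [YoungDiagram.mem_cells, YoungDiagram.mem_cells, YoungDiagram.mem_iff_lt_rowLen,
        YoungDiagram.mem_iff_lt_rowLen, hrow]
    · rintro ⟨rfl, rfl⟩
      ext i
      simp [Finsupp.indicator_apply]
  rw [alternant, Matrix.det_apply', MvPolynomial.coeff_sum]
  have : ∀ σ : Equiv.Perm (Fin N), MvPolynomial.coeff
      (Finsupp.equivFunOnFinite.symm fun i : Fin N => ν.rowLen i + (N - 1 - i))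
      (((Equiv.Perm.sign σ : ℤ) : MvPolynomial (Fin N) ℤ) * ∏ i, (Matrix.of fun i j : Fin N =>
        (MvPolynomial.X j : MvPolynomial (Fin N) ℤ) ^ (μ.rowLen i + (N - 1 - i))) (σ i) i) =
      if σ = 1 then (if μ = ν then 1 else 0) else 0 := by
    intro σ
    have hC : ((Equiv.Perm.sign σ : ℤ) : MvPolynomial (Fin N) ℤ) =
        MvPolynomial.C (Equiv.Perm.sign σ : ℤ) := by simp
    rw [hC, MvPolynomial.coeff_C_mul]
    simp only [Matrix.of_apply]
    rw [key σ]
    by_cases h1 : σ = 1 <;> by_cases h2 : μ = ν <;> simp [h1, h2]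
  rw [Finset.sum_congr rfl fun σ _ => this σ]
  simp

/-- The expansion of a product of Schur functions is unique. -/
theorem IsSchurExpansion.unique {α β : YoungDiagram} {c d : YoungDiagram →₀ ℕ}
    (hc : IsSchurExpansion α β c) (hd : IsSchurExpansion α β d) : c = d := by
  classical
  set S := c.support ∪ d.support with hS
  obtain ⟨N, hN⟩ : ∃ N, ∀ γ ∈ S, γ.colLen 0 ≤ N :=
    ⟨S.sup fun γ => γ.colLen 0, fun γ hγ => Finset.le_sup (f := fun γ => γ.colLen 0) hγ⟩
  have ext1 : ∀ e : YoungDiagram →₀ ℕ, e.support ⊆ S →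
      ∑ γ ∈ e.support, (e γ : FractionRing (MvPolynomial (Fin N) ℤ)) * schur N γ =
        algebraMap (MvPolynomial (Fin N) ℤ) _ (∑ γ ∈ S, (e γ : MvPolynomial (Fin N) ℤ) *
          alternant N γ) / algebraMap (MvPolynomial (Fin N) ℤ) _ (alternant N ⊥) := by
    intro e he
    rw [Finset.sum_subset he fun γ _ hγ => by simp [Finsupp.notMem_support_iff.1 hγ],
      map_sum, Finset.sum_div]
    refine Finset.sum_congr rfl fun γ hγ => ?_
    rw [schur, if_pos (hN γ hγ), map_mul, map_natCast, mul_div_assoc]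
  have hbot : (⊥ : YoungDiagram).colLen 0 ≤ N := by
    by_contra h
    exact YoungDiagram.notMem_bot _ (YoungDiagram.mem_iff_lt_colLen.2
      (Nat.lt_of_le_of_lt (Nat.zero_le _) (not_le.1 h)))
  have hne : algebraMap (MvPolynomial (Fin N) ℤ) (FractionRing (MvPolynomial (Fin N) ℤ))
      (alternant N ⊥) ≠ 0 := by
    intro h
    rw [map_eq_zero_iff _ (IsFractionRing.injective _ _)] at h
    have := coeff_alternant N ⊥ ⊥ hbot hbot
    rw [h] at this
    simp at this
  have heq := (hc N).symm.trans (hd N)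
  rw [ext1 c Finset.subset_union_left, ext1 d Finset.subset_union_right,
    div_left_inj' hne] at heq
  have heq := IsFractionRing.injective _ _ heq
  have hco : ∀ e : YoungDiagram →₀ ℕ, ∀ ν ∈ S, MvPolynomial.coeff
      (Finsupp.equivFunOnFinite.symm fun i : Fin N => ν.rowLen i + (N - 1 - i))
      (∑ γ ∈ S, (e γ : MvPolynomial (Fin N) ℤ) * alternant N γ) = e ν := by
    intro e ν hν
    rw [MvPolynomial.coeff_sum, Finset.sum_eq_single_of_mem ν hν]
    · have hC : ((e ν : ℕ) : MvPolynomial (Fin N) ℤ) = MvPolynomial.C (e ν : ℤ) := by simp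
      rw [hC, MvPolynomial.coeff_C_mul, coeff_alternant N ν ν (hN ν hν) (hN ν hν)]
      simp
    · intro γ hγ hne
      have hC : ((e γ : ℕ) : MvPolynomial (Fin N) ℤ) = MvPolynomial.C (e γ : ℤ) := by simp
      rw [hC, MvPolynomial.coeff_C_mul, coeff_alternant N γ ν (hN γ hγ) (hN ν hν)]
      simp [hne]
  ext ν
  by_cases hν : ν ∈ S
  · have h1 := hco c ν hν
    rw [heq, hco d ν hν] at h1
    exact_mod_cast h1.symm
  · rw [hS, Finset.mem_union, not_or] at hν
    rw [Finsupp.notMem_support_iff.1 hν.1, Finsupp.notMem_support_iff.1 hν.2]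

open Classical in
/-- The Littlewood–Richardson coefficient `N_{α,β}^γ`: the coefficient of `s_γ` in the expansion
of `s_α s_β` in Schur functions.  The expansion is unique by `IsSchurExpansion.unique`. -/
noncomputable def lrCoeff (α β γ : YoungDiagram) : ℕ :=
  if h : ∃ c, IsSchurExpansion α β c then h.choose γ else 0

/-- The hook `η_{n,r} = (n - r, 1, …, 1)` with `r` ones, for `0 ≤ r ≤ n - 1`. -/
def hook (n r : ℕ) (h : r < n) : YoungDiagram :=
  YoungDiagram.ofRowLens ((n - r) :: List.replicate r 1) <| by
    rw [List.sortedGE_iff_pairwise]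
    refine List.pairwise_cons.2 ⟨fun a ha => ?_, List.pairwise_replicate.2 (Or.inr le_rfl)⟩
    rw [List.eq_of_mem_replicate ha]
    omega

/-- The set of boxes of `β / α`; the box `(i, j)` is in row `i` and column `j`, rows being
numbered downwards. -/
def skew (β α : YoungDiagram) : Finset (ℕ × ℕ) := β.cells \ α.cells

/-- Two boxes are adjacent if they share an edge. -/
def boxGraph : SimpleGraph (ℕ × ℕ) where
  Adj a b := (a.1 = b.1 ∧ (a.2 + 1 = b.2 ∨ b.2 + 1 = a.2)) ∨
    (a.2 = b.2 ∧ (a.1 + 1 = b.1 ∨ b.1 + 1 = a.1))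
  symm := ⟨fun a b h => by omega⟩
  loopless := ⟨fun a h => by omega⟩

/-- The number of connected components of a set of boxes. -/
noncomputable def numComponents (S : Finset (ℕ × ℕ)) : ℕ :=
  Nat.card (boxGraph.induce (S : Set (ℕ × ℕ))).ConnectedComponent

/-- The number of vertical dominoes in a set of boxes: pairs of boxes, one immediately
above the other. -/
def numVerticalDominoes (S : Finset (ℕ × ℕ)) : ℕ :=
  {b ∈ S | (b.1 + 1, b.2) ∈ S}.card

/-- The set of boxes contains a `2 × 2` square. -/
def ContainsSquare (S : Finset (ℕ × ℕ)) : Prop :=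
  ∃ i j : ℕ, (i, j) ∈ S ∧ (i, j + 1) ∈ S ∧ (i + 1, j) ∈ S ∧ (i + 1, j + 1) ∈ S

end SchurHook

namespace SchurHook

/-! All hooks are encoded at once by ∏ (1 + y z_j)/(1 - x z_j) = 1 + (x + y) ∑ x^(n-1-r) y^r s_η,
the sum being over the hooks η = η_{n,r}. Multiplying the alternant a_α by this product gives ∑
w(β/α) a_β, where w vanishes unless α ⊆ β and β/α has no 2×2 square, and otherwise w = x^c y^v (x +
y)^k with c + v + k = |β/α|. Removing the term β = α, dividing by x + y and reading off x^(n-1-r)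
y^r leaves the binomial coefficient (k-1 over r-v).

The expansion in alternants is `prod_mul_sum_stripWeight`, a row reduction of determinants;
`stripWeight_eq` and `stripWeight_eq_zero` compute w. Power series are avoided by letting x be
nilpotent and then lifting to polynomials modulo x^D (`pow_dvd_sum_stripWeight`). The hook side is
itself the case α = ⊥ (`hookCoeff_bot`), so it suffices to compare α with ⊥
(`alternantAt_bot_mul_sum_hookCoeff`). Uniqueness of Schur expansions finishes the proof. -/

open Finset

/-! ### Row weights and the determinant identity. -/

section Ring

variable {R : Type*} [CommRing R]

/-- The weight of moving a row from `lo` to `m` when the row above is at `hi`. -/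
def stripEntry (x y : R) (lo hi m : ℕ) : R :=
  if m < lo then 0 else if m = lo then 1 else
    if m < hi then x ^ (m - lo - 1) * (x + y) else if m = hi then x ^ (m - lo - 1) * y else 0

theorem stripEntry_eq_zero_of_lt (x y : R) {lo hi m : ℕ} (h : m < lo) :
    stripEntry x y lo hi m = 0 := by
  simp [stripEntry, h]

theorem stripEntry_eq_zero_of_gt (x y : R) {lo hi m : ℕ} (hlo : lo < hi) (h : hi < m) :
    stripEntry x y lo hi m = 0 := by
  rw [stripEntry, if_neg (by omega), if_neg (by omega), if_neg (by omega), if_neg (by omega)]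

theorem sum_range_stripEntry (x y t : R) (lo d : ℕ) :
    (1 - x * t) * ∑ m ∈ range (lo + d + 1), stripEntry x y lo (lo + d + 1) m * t ^ m =
      (1 + y * t) * t ^ lo - x ^ d * (x + y) * t ^ (lo + d + 1) := by
  have h : ∑ m ∈ range (lo + d + 1), stripEntry x y lo (lo + d + 1) m * t ^ m =
      t ^ lo + ∑ k ∈ range d, x ^ k * (x + y) * t ^ (lo + k + 1) := by
    rw [add_assoc, sum_range_add, sum_eq_zero, zero_add, sum_range_succ', add_comm]
    · congr 1
      · simp [stripEntry]
      · refine sum_congr rfl fun k hk => ?_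
        have := mem_range.1 hk
        rw [stripEntry, if_neg (by omega), if_neg (by omega), if_pos (by omega),
          show lo + (k + 1) - lo - 1 = k by omega, ← add_assoc lo k 1]
    · intro m hm
      rw [stripEntry_eq_zero_of_lt x y (mem_range.1 hm), zero_mul]
  rw [h]
  clear h
  induction d with
  | zero => simp; ring
  | succ d ih =>
    rw [sum_range_succ, ← add_assoc, mul_add, ih]
    ring

/-- The geometric series stops at `hi`; the boundary value `x ^ (hi - lo - 1) * y` there is exactly
what makes 1 + y t factor out. -/
theorem sum_range_stripEntry_of_lt (x y t : R) {lo hi L : ℕ} (hlo : lo < hi) (hL : hi < L) :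
    (1 - x * t) * ∑ m ∈ range L, stripEntry x y lo hi m * t ^ m =
      (1 + y * t) * (t ^ lo - x ^ (hi - lo) * t ^ hi) := by
  obtain ⟨d, rfl⟩ : ∃ d, hi = lo + d + 1 := ⟨hi - lo - 1, by omega⟩
  have h : ∑ m ∈ range L, stripEntry x y lo (lo + d + 1) m * t ^ m =
      ∑ m ∈ range (lo + d + 1 + 1), stripEntry x y lo (lo + d + 1) m * t ^ m := by
    symm
    refine sum_subset (fun m hm => mem_range.2 ?_) fun m _ hm => ?_
    · have := mem_range.1 hm
      omega
    · rw [mem_range] at hm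
      rw [stripEntry_eq_zero_of_gt x y hlo (by omega), zero_mul]
  rw [h, sum_range_succ, mul_add, sum_range_stripEntry]
  have h2 : stripEntry x y lo (lo + d + 1) (lo + d + 1) = x ^ d * y := by
    rw [stripEntry, if_neg (by omega), if_neg (by omega), if_neg (by omega), if_pos rfl,
      show lo + d + 1 - lo - 1 = d by omega]
  rw [h2, show lo + d + 1 - lo = d + 1 by omega]
  ring

/-- For the top row, `L` is a mere cutoff, and nilpotence of `x` kills the tail of the geometric
series. -/
theorem sum_range_stripEntry_self (x y t : R) {lo L D : ℕ} (hx : x ^ D = 0) (hL : lo + D < L) :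
    (1 - x * t) * ∑ m ∈ range L, stripEntry x y lo L m * t ^ m = (1 + y * t) * t ^ lo := by
  obtain ⟨d, rfl⟩ : ∃ d, L = lo + d + 1 := ⟨L - lo - 1, by omega⟩
  rw [sum_range_stripEntry, pow_eq_zero_of_le (by omega : D ≤ d) hx]
  ring

/-- The position of the row above row `i`, or `L` for the top row. -/
def rowAbove {N : ℕ} (μ : Fin N → ℕ) (L : ℕ) (i : Fin N) : ℕ :=
  if h : (i : ℕ) = 0 then L else μ ⟨i - 1, by omega⟩

theorem rowAbove_zero {n : ℕ} (μ : Fin (n + 1) → ℕ) (L : ℕ) : rowAbove μ L 0 = L := by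
  simp [rowAbove]

theorem rowAbove_succ {n : ℕ} (μ : Fin (n + 1) → ℕ) (L : ℕ) (i : Fin n) :
    rowAbove μ L i.succ = μ i.castSucc := by
  simp [rowAbove]
  rfl

/-- Multilinearity of the determinant in its rows. -/
theorem sum_prod_mul_det {N : ℕ} (z : Fin N → R) (g : Fin N → ℕ → R) (L : ℕ) :
    ∑ ν ∈ Fintype.piFinset fun _ : Fin N => range L,
      (∏ i, g i (ν i)) * (Matrix.of fun i j => z j ^ ν i).det =
        (Matrix.of fun i j => ∑ m ∈ range L, g i m * z j ^ m).det := by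
  have h := (Matrix.detRowAlternating (R := R) (n := Fin N)).toMultilinearMap.map_sum_finset
    (fun i m => fun j => g i m * z j ^ m) (fun _ => range L)
  have h2 : (Matrix.of fun i j => ∑ m ∈ range L, g i m * z j ^ m) =
      fun i => ∑ m ∈ range L, fun j => g i m * z j ^ m := by
    ext i j
    simp
  rw [h2]
  refine Eq.trans (sum_congr rfl fun ν _ => ?_) h.symm
  exact (Matrix.det_mul_column (fun i => g i (ν i)) (Matrix.of fun i j => z j ^ ν i)).symm

theorem prod_mul_sum_stripEntry_mul_det {N : ℕ} (x y : R) (z : Fin N → R) {μ : Fin N → ℕ}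
    (hμ : StrictAnti μ) {L D : ℕ} (hx : x ^ D = 0) (hL : ∀ i, μ i + D < L) :
    (∏ j, (1 - x * z j)) * ∑ ν ∈ Fintype.piFinset fun _ : Fin N => range L,
      (∏ i, stripEntry x y (μ i) (rowAbove μ L i) (ν i)) * (Matrix.of fun i j => z j ^ ν i).det =
        (∏ j, (1 + y * z j)) * (Matrix.of fun i j => z j ^ μ i).det := by
  rw [sum_prod_mul_det, ← Matrix.det_mul_row, ← Matrix.det_mul_row]
  cases N with
  | zero => simp
  | succ n =>
    symm
    -- Row i of the weighted matrix is (1 + y z) z^(μ_i) minus a multiple of (1 + y z) z^(μ_(i-1)),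
    -- so the two matrices differ by row operations.
    refine Matrix.det_eq_of_forall_row_eq_smul_add_pred
      (fun i => x ^ (μ i.castSucc - μ i.succ)) (fun j => ?_) fun i j => ?_
    · simp only [Matrix.of_apply, rowAbove_zero]
      rw [sum_range_stripEntry_self x y _ hx (hL 0)]
    · simp only [Matrix.of_apply, rowAbove_succ]
      rw [sum_range_stripEntry_of_lt x y _ (hμ i.castSucc_lt_succ)
        (by have := hL i.castSucc; omega)]
      ring

end Ring

/-! ### Diagrams in a rectangle -/

theorem finite_cells_subset (S : Finset (ℕ × ℕ)) : {β : YoungDiagram | β.cells ⊆ S}.Finite := by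
  refine Set.Finite.of_injOn (f := YoungDiagram.cells) (t := (S.powerset : Set (Finset (ℕ × ℕ))))
    (fun β hβ => ?_) (fun β _ γ _ h => YoungDiagram.ext h) (Finset.finite_toSet _)
  simpa using hβ

/-- The Young diagrams with at most `N` rows and at most `W` columns. -/
noncomputable def boxed (N W : ℕ) : Finset YoungDiagram :=
  (finite_cells_subset (range N ×ˢ range W)).toFinset

theorem colLen_zero_le_iff {β : YoungDiagram} {N : ℕ} : β.colLen 0 ≤ N ↔ β.rowLen N = 0 := by
  rw [← not_lt, ← YoungDiagram.mem_iff_lt_colLen, YoungDiagram.mem_iff_lt_rowLen]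
  omega

theorem mem_boxed {N W : ℕ} {β : YoungDiagram} :
    β ∈ boxed N W ↔ β.colLen 0 ≤ N ∧ β.rowLen 0 ≤ W := by
  simp only [boxed, Set.Finite.mem_toFinset, Set.mem_ofPred_eq]
  constructor
  · intro h
    constructor
    · by_contra! hc
      have := h ((YoungDiagram.mem_cells _).2 (YoungDiagram.mem_iff_lt_colLen.2 hc))
      simp at this
    · by_contra! hc
      have := h ((YoungDiagram.mem_cells _).2 (YoungDiagram.mem_iff_lt_rowLen.2 hc))
      simp at this
  · rintro ⟨h1, h2⟩ ⟨i, j⟩ hc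
    rw [YoungDiagram.mem_cells] at hc
    have hi := YoungDiagram.mem_iff_lt_colLen.1 (β.up_left_mem le_rfl (Nat.zero_le j) hc)
    have hj := YoungDiagram.mem_iff_lt_rowLen.1 (β.up_left_mem (Nat.zero_le i) le_rfl hc)
    simp only [mem_product, mem_range]
    omega

theorem ext_rowLen {μ ν : YoungDiagram} (h : ∀ i, μ.rowLen i = ν.rowLen i) : μ = ν := by
  ext ⟨i, j⟩
  rw [YoungDiagram.mem_cells, YoungDiagram.mem_cells, YoungDiagram.mem_iff_lt_rowLen,
    YoungDiagram.mem_iff_lt_rowLen, h]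

theorem rowLen_eq_zero_of_le {β : YoungDiagram} {N i : ℕ} (h : β.colLen 0 ≤ N) (hi : N ≤ i) :
    β.rowLen i = 0 := by
  rw [← colLen_zero_le_iff]
  omega

theorem exists_rowLen_eq {N : ℕ} {f : ℕ → ℕ} (hf : Antitone f) (h0 : ∀ i, N ≤ i → f i = 0) :
    ∃ β : YoungDiagram, ∀ i, β.rowLen i = f i := by
  let β : YoungDiagram :=
    { cells := (range N ×ˢ range (f 0)).filter fun c => c.2 < f c.1
      isLowerSet := by
        rintro ⟨i, j⟩ ⟨i', j'⟩ ⟨hi, hj⟩ hc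
        simp only [coe_filter, mem_product, mem_range, Set.mem_ofPred_eq] at hc ⊢
        simp only at hi hj
        have := hf hi
        omega }
  have hβ : ∀ i j, (i, j) ∈ β ↔ j < f i := by
    intro i j
    rw [← YoungDiagram.mem_cells]
    simp only [β, mem_filter, mem_product, mem_range]
    refine ⟨fun h => h.2, fun h => ⟨⟨?_, h.trans_le (hf (Nat.zero_le i))⟩, h⟩⟩
    by_contra! hi
    have := h0 i hi
    omega
  refine ⟨β, fun i => ?_⟩
  have h1 := hβ i (f i)
  have h2 := hβ i (β.rowLen i)
  rw [YoungDiagram.mem_iff_lt_rowLen] at h1 h2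
  omega

/-- The exponents of the diagonal monomial of the alternant of `μ`. -/
def shifted (N : ℕ) (μ : YoungDiagram) (i : Fin N) : ℕ := μ.rowLen i + (N - 1 - i)

theorem strictAnti_shifted (N : ℕ) (μ : YoungDiagram) : StrictAnti (shifted N μ) := by
  intro i j hij
  have h1 := μ.rowLen_anti i j (le_of_lt hij)
  have h2 : (i : ℕ) < j := hij
  have h3 := j.2
  simp only [shifted]
  omega

theorem shifted_injOn (N : ℕ) {μ ν : YoungDiagram} (hμ : μ.colLen 0 ≤ N) (hν : ν.colLen 0 ≤ N)
    (h : shifted N μ = shifted N ν) : μ = ν := by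
  refine ext_rowLen fun i => ?_
  by_cases hi : i < N
  · have := congrFun h ⟨i, hi⟩
    simp only [shifted] at this
    omega
  · rw [rowLen_eq_zero_of_le hμ (by omega), rowLen_eq_zero_of_le hν (by omega)]

theorem exists_shifted_eq {N W : ℕ} {ν : Fin N → ℕ} (hν : StrictAnti ν) (hW : ∀ i, ν i < W + N) :
    ∃ β ∈ boxed N W, shifted N β = ν := by
  -- A strictly decreasing sequence of naturals drops by at least one per step, so subtracting the
  -- staircase N - 1 - i leaves a partition.
  have hgap : ∀ k (i j : Fin N), (j : ℕ) = i + k → ν j + k ≤ ν i := by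
    intro k
    induction k with
    | zero =>
      intro i j hij
      have : i = j := Fin.ext (by omega)
      simp [this]
    | succ k ih =>
      intro i j hij
      have hj := j.2
      have h1 := ih i ⟨i + k, by omega⟩ rfl
      have h2 : ν j < ν ⟨i + k, by omega⟩ := hν (Fin.lt_def.2 (by simp only; omega))
      omega
  obtain ⟨β, hβ⟩ := exists_rowLen_eq (N := N)
    (f := fun i => if h : i < N then ν ⟨i, h⟩ - (N - 1 - i) else 0)
    (fun i j hij => by
      by_cases hj : j < N
      · have hi : i < N := by omega
        have := hgap (j - i) ⟨i, hi⟩ ⟨j, hj⟩ (by simp only; omega)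
        simp only [hi, hj, dite_true]
        omega
      · simp [hj]) (fun i hi => by simp; omega)
  refine ⟨β, mem_boxed.2 ⟨?_, ?_⟩, ?_⟩
  · rw [colLen_zero_le_iff, hβ]
    simp
  · rw [hβ]
    by_cases h : 0 < N
    · have := hW ⟨0, h⟩
      simp only [h, dite_true]
      omega
    · simp [h]
  · funext i
    have hi := i.2
    have h1 := hgap (N - 1 - i) i ⟨N - 1, by omega⟩ (by simp only; omega)
    rw [shifted, hβ]
    simp only [i.2, dite_true, Fin.eta]
    omega

/-! ### Expansion of the product in alternants. -/

section Alternants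

variable {R : Type*} [CommRing R]

/-- The alternant of `μ` evaluated at `z`. -/
def alternantAt {N : ℕ} (z : Fin N → R) (μ : YoungDiagram) : R :=
  (Matrix.of fun i j => z j ^ shifted N μ i).det

theorem alternantAt_X (N : ℕ) (μ : YoungDiagram) :
    alternantAt (fun i : Fin N => (MvPolynomial.X i : MvPolynomial (Fin N) ℤ)) μ =
      alternant N μ := rfl

theorem map_alternantAt {S : Type*} [CommRing S] (f : R →+* S) {N : ℕ} (z : Fin N → R)
    (μ : YoungDiagram) : f (alternantAt z μ) = alternantAt (fun i => f (z i)) μ := by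
  rw [alternantAt, RingHom.map_det, alternantAt]
  congr 1
  ext i j
  simp

/-- Nonzero weights confine ν_i to the interval from μ_i to μ_(i-1). Consecutive intervals share
only an endpoint, so ν is weakly decreasing, and a tie gives two equal rows. -/
theorem det_eq_zero_of_not_strictAnti {N : ℕ} (x y : R) (z : Fin N → R) {μ ν : Fin N → ℕ}
    (hμ : StrictAnti μ) (L : ℕ) (hν : ¬ StrictAnti ν) :
    (∏ i, stripEntry x y (μ i) (rowAbove μ L i) (ν i)) *
      (Matrix.of fun i j => z j ^ ν i).det = 0 := by
  by_contra hne
  apply hν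
  have hp := left_ne_zero_of_mul hne
  have hd := right_ne_zero_of_mul hne
  have h1 : ∀ i, stripEntry x y (μ i) (rowAbove μ L i) (ν i) ≠ 0 := fun i h =>
    hp (prod_eq_zero (mem_univ i) h)
  cases N with
  | zero => exact fun i => i.elim0
  | succ n =>
    rw [Fin.strictAnti_iff_succ_lt]
    intro i
    have hup : ν i.succ ≤ μ i.castSucc := by
      by_contra! hc
      apply h1 i.succ
      rw [rowAbove_succ]
      exact stripEntry_eq_zero_of_gt x y (hμ i.castSucc_lt_succ) hc
    have hlo : μ i.castSucc ≤ ν i.castSucc := by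
      by_contra! hc
      exact h1 i.castSucc (stripEntry_eq_zero_of_lt x y hc)
    refine lt_of_le_of_ne (hup.trans hlo) fun heq => hd ?_
    refine Matrix.det_zero_of_row_eq i.castSucc_lt_succ.ne ?_
    ext j
    simp [heq]

/-- The product over the rows of the weights of `β` relative to `α`. -/
def stripWeight (x y : R) (N W : ℕ) (α β : YoungDiagram) : R :=
  ∏ i : Fin N, stripEntry x y (shifted N α i) (rowAbove (shifted N α) (W + N) i) (shifted N β i)

theorem prod_mul_sum_stripWeight {N W D : ℕ} (x y : R) (z : Fin N → R) {α : YoungDiagram}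
    (hx : x ^ D = 0) (hα : α.rowLen 0 + D ≤ W) :
    (∏ j, (1 - x * z j)) * ∑ β ∈ boxed N W, stripWeight x y N W α β * alternantAt z β =
      (∏ j, (1 + y * z j)) * alternantAt z α := by
  rw [alternantAt, ← prod_mul_sum_stripEntry_mul_det x y z (strictAnti_shifted N α) (L := W + N)
    hx (fun i => by
      have := α.rowLen_anti 0 i (Nat.zero_le _)
      have := i.2
      simp only [shifted]
      omega)]
  congr 1
  classical
  rw [← sum_filter_of_ne (p := StrictAnti) (fun ν _ h => by
    by_contra hν
    exact h (det_eq_zero_of_not_strictAnti x y z (strictAnti_shifted N α) _ hν))]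
  refine sum_bij (fun β _ => shifted N β) (fun β hβ => ?_)
    (fun β hβ γ hγ h => shifted_injOn N (mem_boxed.1 hβ).1 (mem_boxed.1 hγ).1 h)
    (fun ν hν => ?_) (fun β _ => rfl)
  · refine mem_filter.2 ⟨Fintype.mem_piFinset.2 fun i => mem_range.2 ?_, strictAnti_shifted N β⟩
    have := β.rowLen_anti 0 i (Nat.zero_le _)
    have := (mem_boxed.1 hβ).2
    have := i.2
    simp only [shifted]
    omega
  · obtain ⟨h1, h2⟩ := mem_filter.1 hν
    obtain ⟨β, hβ, rfl⟩ := exists_shifted_eq (W := W) h2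
      fun i => mem_range.1 (Fintype.mem_piFinset.1 h1 i)
    exact ⟨β, hβ, rfl⟩

/-- After multiplication by the unit ∏ (1 - x z_j), both sides become ∏ (1 + y z_j) times the two
alternants. -/
theorem alternantAt_bot_mul_sum_stripWeight {N W D : ℕ} (x y : R) (z : Fin N → R)
    {α : YoungDiagram} (hx : x ^ D = 0) (hα : α.rowLen 0 + D ≤ W) :
    alternantAt z ⊥ * ∑ β ∈ boxed N W, stripWeight x y N W α β * alternantAt z β =
      alternantAt z α * ∑ β ∈ boxed N W, stripWeight x y N W ⊥ β * alternantAt z β := by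
  have hu : IsUnit (∏ j, (1 - x * z j)) := by
    refine IsUnit.prod_univ_iff.2 fun j => IsNilpotent.isUnit_one_sub ⟨D, ?_⟩
    rw [mul_pow, hx, zero_mul]
  have hbot : (⊥ : YoungDiagram).rowLen 0 = 0 := by
    by_contra h
    exact YoungDiagram.notMem_bot _ (YoungDiagram.mem_iff_lt_rowLen.2 (Nat.pos_of_ne_zero h))
  have h1 := prod_mul_sum_stripWeight x y z hx hα
  have h2 := prod_mul_sum_stripWeight (W := W) (α := ⊥) x y z hx (by omega)
  refine hu.mul_left_cancel ?_
  linear_combination alternantAt z ⊥ * h1 - alternantAt z α * h2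

end Alternants

/-! ### Rows of skew diagrams -/

theorem mem_skew {α β : YoungDiagram} {i j : ℕ} :
    (i, j) ∈ skew β α ↔ α.rowLen i ≤ j ∧ j < β.rowLen i := by
  rw [skew, mem_sdiff, YoungDiagram.mem_cells, YoungDiagram.mem_cells,
    YoungDiagram.mem_iff_lt_rowLen, YoungDiagram.mem_iff_lt_rowLen, not_lt, and_comm]

theorem le_iff_rowLen {α β : YoungDiagram} : α ≤ β ↔ ∀ i, α.rowLen i ≤ β.rowLen i := by
  constructor
  · intro h i
    by_contra! hc
    exact lt_irrefl _ (YoungDiagram.mem_iff_lt_rowLen.1 (h (YoungDiagram.mem_iff_lt_rowLen.2 hc)))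
  · rintro h ⟨i, j⟩ hc
    exact YoungDiagram.mem_iff_lt_rowLen.2 ((YoungDiagram.mem_iff_lt_rowLen.1 hc).trans_le (h i))

theorem not_containsSquare_iff {α β : YoungDiagram} :
    ¬ ContainsSquare (skew β α) ↔ ∀ i, β.rowLen (i + 1) ≤ α.rowLen i + 1 := by
  simp only [ContainsSquare, mem_skew]
  constructor
  · intro hs i
    by_contra! hc
    have h1 := β.rowLen_anti i (i + 1) (by omega)
    have h2 := α.rowLen_anti i (i + 1) (by omega)
    -- If row i + 1 overshoots, the columns `α.rowLen i` and the next one lie in both rows of the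
    -- skew shape.
    exact hs ⟨i, α.rowLen i, by omega, by omega, by omega, by omega⟩
  · rintro hr ⟨i, j, h1, h2, h3, h4⟩
    have := hr i
    omega

theorem card_eq_sum_rowLen {β : YoungDiagram} {N : ℕ} (h : β.colLen 0 ≤ N) :
    β.card = ∑ i ∈ range N, β.rowLen i := by
  rw [YoungDiagram.card, card_eq_sum_card_fiberwise (f := Prod.fst) (t := range N)]
  · exact sum_congr rfl fun i _ => β.rowLen_eq_card.symm
  · rintro ⟨i, j⟩ hc
    have hc' : (i, j) ∈ β := hc
    have := YoungDiagram.mem_iff_lt_colLen.1 (β.up_left_mem le_rfl (Nat.zero_le j) hc')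
    simp only [coe_range, Set.mem_Iio]
    omega

/-- Row `i` of `β / α` has a box below a box of row `i - 1`. -/
def Linked (α β : YoungDiagram) (i : ℕ) : Prop := 0 < i ∧ α.rowLen (i - 1) < β.rowLen i

instance (α β : YoungDiagram) : DecidablePred (Linked α β) := fun _ => instDecidableAnd

/-- Row `i` of `β / α` is nonempty and has no box below a box of row `i - 1`. -/
def TopRow (α β : YoungDiagram) (i : ℕ) : Prop := α.rowLen i < β.rowLen i ∧ ¬ Linked α β i

instance (α β : YoungDiagram) : DecidablePred (TopRow α β) := fun _ => instDecidableAnd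

theorem Linked.lt {α β : YoungDiagram} {i : ℕ} (h : Linked α β i) : α.rowLen i < β.rowLen i :=
  (α.rowLen_anti (i - 1) i (by omega)).trans_lt h.2

/-- Without a 2×2 square, two consecutive rows overlap in at most one column, so a domino is
determined by its lower row. -/
theorem numVerticalDominoes_skew {α β : YoungDiagram} {N : ℕ}
    (hs : ∀ i, β.rowLen (i + 1) ≤ α.rowLen i + 1) (hN : β.colLen 0 ≤ N) :
    numVerticalDominoes (skew β α) = {i ∈ range N | Linked α β i}.card := by
  refine card_bij (fun b _ => b.1 + 1) ?_ ?_ ?_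
  · rintro ⟨i, j⟩ hb
    simp only [mem_filter, mem_skew] at hb
    refine mem_filter.2 ⟨mem_range.2 ?_, Nat.succ_pos _, ?_⟩
    · by_contra! hi
      have := rowLen_eq_zero_of_le hN hi
      simp only at this
      omega
    · simp only [Nat.add_sub_cancel]
      omega
  · rintro ⟨i, j⟩ hb ⟨i', j'⟩ hb' h
    simp only [mem_filter, mem_skew] at hb hb'
    obtain rfl : i = i' := by simpa using h
    have := hs i
    ext <;> simp only
    omega
  · intro i hi
    obtain ⟨-, h0, h⟩ := mem_filter.1 hi
    obtain ⟨i, rfl⟩ : ∃ k, i = k + 1 := ⟨i - 1, by omega⟩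
    simp only [Nat.add_sub_cancel] at h
    have h1 := β.rowLen_anti i (i + 1) (by omega)
    have h2 := α.rowLen_anti i (i + 1) (by omega)
    refine ⟨(i, α.rowLen i), ?_, rfl⟩
    simp only [mem_filter, mem_skew]
    omega

/-- The first row of the connected component of `β / α` containing the boxes of row `i`. -/
def componentTop (α β : YoungDiagram) : ℕ → ℕ
  | 0 => 0
  | i + 1 => if α.rowLen i < β.rowLen (i + 1) then componentTop α β i else i + 1

theorem topRow_componentTop {α β : YoungDiagram} :
    ∀ {i : ℕ}, α.rowLen i < β.rowLen i → TopRow α β (componentTop α β i)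
  | 0, h => ⟨h, fun hl => absurd hl.1 (lt_irrefl _)⟩
  | i + 1, h => by
    rw [componentTop]
    split_ifs with hl
    · exact topRow_componentTop (hl.trans_le (β.rowLen_anti i (i + 1) (by omega)))
    · exact ⟨h, fun h' => hl h'.2⟩

theorem TopRow.componentTop_eq {α β : YoungDiagram} {i : ℕ} (h : TopRow α β i) :
    componentTop α β i = i := by
  cases i with
  | zero => rfl
  | succ i => exact if_neg fun hl => h.2 ⟨Nat.succ_pos _, hl⟩

theorem reachable_rowStart {α β : YoungDiagram} {i j : ℕ} (h : (i, j) ∈ (skew β α : Set (ℕ × ℕ)))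
    (h0 : (i, α.rowLen i) ∈ (skew β α : Set (ℕ × ℕ))) :
    (boxGraph.induce (skew β α : Set (ℕ × ℕ))).Reachable ⟨_, h⟩ ⟨_, h0⟩ := by
  have hj := (mem_skew.1 (mem_coe.1 h)).1
  induction j, hj using Nat.le_induction with
  | base => rfl
  | succ j hj ih =>
    have h' : (i, j) ∈ (skew β α : Set (ℕ × ℕ)) := by
      have := mem_skew.1 (mem_coe.1 h)
      exact mem_coe.2 (mem_skew.2 ⟨hj, by omega⟩)
    refine SimpleGraph.Reachable.trans (SimpleGraph.Adj.reachable ?_) (ih h')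
    exact Or.inl ⟨rfl, Or.inr rfl⟩

theorem reachable_componentTop {α β : YoungDiagram} :
    ∀ {i j : ℕ} (h : (i, j) ∈ (skew β α : Set (ℕ × ℕ)))
      (h' : (componentTop α β i, α.rowLen (componentTop α β i)) ∈ (skew β α : Set (ℕ × ℕ))),
      (boxGraph.induce (skew β α : Set (ℕ × ℕ))).Reachable ⟨_, h⟩ ⟨_, h'⟩
  | 0, j, h, h' => reachable_rowStart h h'
  | i + 1, j, h, h' => by
    by_cases hl : α.rowLen i < β.rowLen (i + 1)
    · have he : componentTop α β (i + 1) = componentTop α β i := if_pos hl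
      simp only [he] at h' ⊢
      have h1 := β.rowLen_anti i (i + 1) (by omega)
      have h2 := α.rowLen_anti i (i + 1) (by omega)
      have m0 : (i + 1, α.rowLen (i + 1)) ∈ (skew β α : Set (ℕ × ℕ)) :=
        mem_coe.2 (mem_skew.2 (by omega))
      have m1 : (i + 1, α.rowLen i) ∈ (skew β α : Set (ℕ × ℕ)) := mem_coe.2 (mem_skew.2 (by omega))
      have m2 : (i, α.rowLen i) ∈ (skew β α : Set (ℕ × ℕ)) := mem_coe.2 (mem_skew.2 (by omega))
      -- Move along row i + 1 to column `α.rowLen i`, step up, and continue from row i.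
      refine ((reachable_rowStart h m0).trans (reachable_rowStart m1 m0).symm).trans
        (SimpleGraph.Reachable.trans (SimpleGraph.Adj.reachable ?_)
          (reachable_componentTop m2 h'))
      exact Or.inr ⟨rfl, Or.inr rfl⟩
    · have he : componentTop α β (i + 1) = i + 1 := if_neg hl
      simp only [he] at h' ⊢
      exact reachable_rowStart h h'

theorem componentTop_eq_of_adj {α β : YoungDiagram} {a b : ℕ × ℕ} (ha : a ∈ skew β α)
    (hb : b ∈ skew β α) (h : boxGraph.Adj a b) :
    componentTop α β a.1 = componentTop α β b.1 := by
  obtain ⟨i, j⟩ := a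
  obtain ⟨i', j'⟩ := b
  rw [mem_skew] at ha hb
  rcases h with ⟨h1, -⟩ | ⟨h1, h2 | h2⟩
  · exact congrArg _ h1
  · simp only at h1 h2
    subst h1 h2
    exact (if_pos (by omega)).symm
  · simp only at h1 h2
    subst h1 h2
    exact if_pos (by omega)

/-- Each component occupies consecutive rows: `componentTop` is constant along edges, separates
components, and takes precisely the top rows as values. -/
theorem numComponents_skew {α β : YoungDiagram} {N : ℕ} (hN : β.colLen 0 ≤ N) :
    numComponents (skew β α) = {i ∈ range N | TopRow α β i}.card := by
  set G := boxGraph.induce (skew β α : Set (ℕ × ℕ))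
  have hmem : ∀ i, TopRow α β i → (i, α.rowLen i) ∈ (skew β α : Set (ℕ × ℕ)) := fun i h =>
    mem_coe.2 (mem_skew.2 ⟨le_rfl, h.1⟩)
  have htop : ∀ a : (skew β α : Set (ℕ × ℕ)), TopRow α β (componentTop α β a.1.1) := fun a => by
    have h := mem_skew.1 (mem_coe.1 a.2)
    exact topRow_componentTop (h.1.trans_lt h.2)
  have hwalk : ∀ a b : (skew β α : Set (ℕ × ℕ)), ∀ p : G.Walk a b,
      componentTop α β a.1.1 = componentTop α β b.1.1 := by
    intro a b p
    induction p with
    | nil => rfl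
    | cons h _ ih => exact (componentTop_eq_of_adj (Subtype.prop _) (Subtype.prop _) h).trans ih
  let f : G.ConnectedComponent → ℕ := SimpleGraph.ConnectedComponent.lift
    (fun a => componentTop α β a.1.1) fun a b p _ => hwalk a b p
  have hf : Function.Injective f := by
    intro c d
    induction c using SimpleGraph.ConnectedComponent.ind with | _ a =>
    induction d using SimpleGraph.ConnectedComponent.ind with | _ b =>
    intro h
    have h' : componentTop α β a.1.1 = componentTop α β b.1.1 := h
    have ha := reachable_componentTop a.2 (hmem _ (htop a))
    have hb := reachable_componentTop b.2 (hmem _ (htop b))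
    simp only [h'] at ha
    exact SimpleGraph.ConnectedComponent.sound (ha.trans hb.symm)
  have hr : Set.range f = ({i ∈ range N | TopRow α β i} : Finset ℕ) := by
    ext i
    constructor
    · rintro ⟨c, rfl⟩
      induction c using SimpleGraph.ConnectedComponent.ind with | _ a =>
      refine mem_coe.2 (mem_filter.2 ⟨mem_range.2 ?_, htop a⟩)
      by_contra! hc
      have h1 := (htop a).1
      rw [rowLen_eq_zero_of_le (i := componentTop α β a.1.1) hN hc] at h1
      omega
    · intro hi
      have hi := (mem_filter.1 (mem_coe.1 hi)).2
      exact ⟨G.connectedComponentMk ⟨_, hmem i hi⟩, hi.componentTop_eq⟩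
  rw [numComponents, ← Nat.card_range_of_injective hf, hr, Nat.card_coe_set_eq, Set.ncard_coe_finset]

/-- In each nonempty row one box is set aside: it accounts for a domino if the row is linked to the
one above, and for a component otherwise. -/
theorem sum_sub_one_add {α β : YoungDiagram} {N : ℕ} (h : α ≤ β)
    (hs : ∀ i, β.rowLen (i + 1) ≤ α.rowLen i + 1) (hα : α.colLen 0 ≤ N) (hβ : β.colLen 0 ≤ N) :
    α.card + ((∑ i ∈ range N, (β.rowLen i - α.rowLen i - 1)) +
      numVerticalDominoes (skew β α) + numComponents (skew β α)) = β.card := by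
  rw [card_eq_sum_rowLen hα, card_eq_sum_rowLen hβ, numVerticalDominoes_skew hs hβ,
    numComponents_skew hβ, card_filter, card_filter, ← sum_add_distrib, ← sum_add_distrib,
    ← sum_add_distrib]
  refine sum_congr rfl fun i _ => ?_
  have h1 := le_iff_rowLen.1 h i
  by_cases hl : Linked α β i
  · have := hl.lt
    simp only [TopRow, hl, not_true, and_false, if_true, if_false]
    omega
  · by_cases ht : α.rowLen i < β.rowLen i <;> simp only [TopRow, hl, ht, not_false_eq_true,
      and_self, false_and, if_true, if_false] <;> omega

theorem numComponents_pos {α β : YoungDiagram} (h : α ≤ β) (hne : β ≠ α) :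
    0 < numComponents (skew β α) := by
  obtain ⟨i, hi⟩ : ∃ i, α.rowLen i < β.rowLen i := by
    by_contra! hc
    exact hne (ext_rowLen fun i => le_antisymm (hc i) (le_iff_rowLen.1 h i))
  rw [numComponents_skew le_rfl, card_pos]
  refine ⟨componentTop α β i, mem_filter.2 ⟨mem_range.2 ?_, topRow_componentTop hi⟩⟩
  by_contra! hc
  have h1 := (topRow_componentTop hi).1
  rw [rowLen_eq_zero_of_le le_rfl hc] at h1
  omega

/-! ### The weight of a skew diagram. -/

section Weight

variable {R : Type*} [CommRing R]

/-- In shifted coordinates, reaching the row above means β_i = α_(i-1) + 1, that is, a linked row;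
stopping short of it after moving means a top row. -/
theorem stripEntry_eq {N W : ℕ} (x y : R) {α β : YoungDiagram} (h : α ≤ β)
    (hs : ∀ i, β.rowLen (i + 1) ≤ α.rowLen i + 1) (hβ : β.rowLen 0 ≤ W) (i : Fin N) :
    stripEntry x y (shifted N α i) (rowAbove (shifted N α) (W + N) i) (shifted N β i) =
      x ^ (β.rowLen i - α.rowLen i - 1) * (if Linked α β i then y else 1) *
        (if TopRow α β i then x + y else 1) := by
  have h1 := le_iff_rowLen.1 h i
  have h0 := i.2
  have hsub : shifted N β i - shifted N α i - 1 = β.rowLen i - α.rowLen i - 1 := by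
    simp only [shifted]
    omega
  rw [stripEntry, if_neg (by simp only [shifted]; omega), hsub]
  by_cases he : β.rowLen i = α.rowLen i
  · rw [if_pos (by simp only [shifted]; omega), if_neg (fun hl => hl.lt.ne' he),
      if_neg (fun ht => ht.1.ne' he), he]
    simp
  rw [if_neg (by simp only [shifted]; omega)]
  by_cases hl : Linked α β i
  · have hl0 := hl.1
    have hl1 := hl.2
    have hl2 := hs (i - 1)
    rw [show (i : ℕ) - 1 + 1 = i by omega] at hl2
    have hb : rowAbove (shifted N α) (W + N) i = shifted N β i := by
      rw [rowAbove, dif_neg (by omega)]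
      simp only [shifted]
      omega
    rw [hb, if_neg (lt_irrefl _), if_pos rfl, if_pos hl, if_neg fun ht => ht.2 hl, mul_one]
  · have hb : shifted N β i < rowAbove (shifted N α) (W + N) i := by
      rw [rowAbove]
      split_ifs with hi
      -- Row 0 never reaches the cutoff `W + N`, because β has at most `W` columns.
      · have := β.rowLen_anti 0 i (Nat.zero_le _)
        simp only [shifted]
        omega
      · have : ¬ α.rowLen (i - 1) < β.rowLen i := fun hc => hl ⟨by omega, hc⟩
        simp only [shifted]
        omega
    rw [if_pos hb, if_neg hl, if_pos ⟨by omega, hl⟩, mul_one]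

theorem stripWeight_eq {N W : ℕ} (x y : R) {α β : YoungDiagram} (h : α ≤ β)
    (hs : ¬ ContainsSquare (skew β α)) (hβ : β ∈ boxed N W) :
    stripWeight x y N W α β = x ^ (∑ i ∈ range N, (β.rowLen i - α.rowLen i - 1)) *
      y ^ numVerticalDominoes (skew β α) * (x + y) ^ numComponents (skew β α) := by
  rw [not_containsSquare_iff] at hs
  obtain ⟨h1, h2⟩ := mem_boxed.1 hβ
  rw [stripWeight, prod_congr rfl fun i _ => stripEntry_eq x y h hs h2 i,
    Fin.prod_univ_eq_prod_range (fun i => x ^ (β.rowLen i - α.rowLen i - 1) *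
      (if Linked α β i then y else 1) * (if TopRow α β i then x + y else 1)),
    prod_mul_distrib, prod_mul_distrib, prod_pow_eq_pow_sum, numVerticalDominoes_skew hs h1,
    numComponents_skew h1, prod_ite, prod_ite]
  simp

theorem stripWeight_eq_zero {N W : ℕ} (x y : R) {α β : YoungDiagram} (hα : α ∈ boxed N W)
    (hβ : β ∈ boxed N W) (h : ¬ (α ≤ β ∧ ¬ ContainsSquare (skew β α))) :
    stripWeight x y N W α β = 0 := by
  by_cases hle : α ≤ β
  · have hs : ¬ ∀ i, β.rowLen (i + 1) ≤ α.rowLen i + 1 := fun hc =>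
      h ⟨hle, not_containsSquare_iff.2 hc⟩
    push Not at hs
    obtain ⟨i, hi⟩ := hs
    have hiN : i + 1 < N := by
      by_contra! hc
      rw [rowLen_eq_zero_of_le (mem_boxed.1 hβ).1 hc] at hi
      omega
    refine prod_eq_zero (mem_univ ⟨i + 1, hiN⟩) (stripEntry_eq_zero_of_gt x y ?_ ?_)
    · rw [rowAbove, dif_neg (by simp)]
      exact strictAnti_shifted N α (Fin.lt_def.2 (by simp))
    · rw [rowAbove, dif_neg (by simp)]
      simp only [shifted, Nat.add_sub_cancel]
      omega
  · rw [le_iff_rowLen] at hle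
    push Not at hle
    obtain ⟨i, hi⟩ := hle
    have hiN : i < N := by
      by_contra! hc
      rw [rowLen_eq_zero_of_le (mem_boxed.1 hα).1 hc] at hi
      omega
    refine prod_eq_zero (mem_univ ⟨i, hiN⟩) (stripEntry_eq_zero_of_lt x y ?_)
    simp only [shifted]
    omega

end Weight

/-! ### Hooks -/

theorem rowLen_bot (i : ℕ) : (⊥ : YoungDiagram).rowLen i = 0 := by
  by_contra h
  exact YoungDiagram.notMem_bot _ (YoungDiagram.mem_iff_lt_rowLen.2 (Nat.pos_of_ne_zero h))

theorem rowLen_pos_iff {β : YoungDiagram} {i : ℕ} : 0 < β.rowLen i ↔ i < β.colLen 0 := by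
  rw [← YoungDiagram.mem_iff_lt_rowLen, YoungDiagram.mem_iff_lt_colLen]

theorem numVerticalDominoes_skew_bot {β : YoungDiagram} (hs : ∀ i, β.rowLen (i + 1) ≤ 1) :
    numVerticalDominoes (skew β ⊥) = β.colLen 0 - 1 := by
  rw [numVerticalDominoes_skew (fun i => by simpa [rowLen_bot] using hs i) le_rfl]
  have : {i ∈ range (β.colLen 0) | Linked ⊥ β i} = Ico 1 (β.colLen 0) := by
    ext i
    simp only [Linked, rowLen_bot, rowLen_pos_iff, mem_filter, mem_range, mem_Ico]
    omega
  rw [this, Nat.card_Ico]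

theorem numComponents_skew_bot {β : YoungDiagram} (hne : β ≠ ⊥) :
    numComponents (skew β ⊥) = 1 := by
  have hp := numComponents_pos bot_le hne
  rw [numComponents_skew le_rfl] at hp ⊢
  refine le_antisymm (card_le_one.2 fun i hi j hj => ?_) hp
  simp only [TopRow, Linked, rowLen_bot, rowLen_pos_iff, mem_filter, mem_range] at hi hj
  omega

theorem rowLen_hook {n r : ℕ} (h : r < n) (i : ℕ) :
    (hook n r h).rowLen i = if i = 0 then n - r else if i ≤ r then 1 else 0 := by
  have key : ∀ j, j < (hook n r h).rowLen i ↔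
      j < if i = 0 then n - r else if i ≤ r then 1 else 0 := by
    intro j
    rw [← YoungDiagram.mem_iff_lt_rowLen, hook, YoungDiagram.mem_ofRowLens]
    rcases i with _ | i
    · simp
    · simp only [List.length_cons, List.length_replicate, Nat.add_lt_add_iff_right,
        List.getElem_cons_succ, List.getElem_replicate, Nat.succ_ne_zero, if_false]
      split_ifs <;> simp <;> omega
  have h1 := key ((hook n r h).rowLen i)
  have h2 := key (if i = 0 then n - r else if i ≤ r then 1 else 0)
  omega

theorem colLen_hook {n r : ℕ} (h : r < n) : (hook n r h).colLen 0 = r + 1 := by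
  have h1 : (hook n r h).colLen 0 ≤ r + 1 := by
    rw [colLen_zero_le_iff, rowLen_hook]
    simp
  have h2 : r < (hook n r h).colLen 0 := by
    rw [← rowLen_pos_iff, rowLen_hook]
    split_ifs <;> omega
  omega

theorem card_of_rowLen_succ_le_one {β : YoungDiagram} (hs : ∀ i, β.rowLen (i + 1) ≤ 1) {r : ℕ}
    (hr : β.colLen 0 = r + 1) : β.card = β.rowLen 0 + r := by
  rw [card_eq_sum_rowLen hr.le, sum_range_succ', add_comm,
    sum_congr rfl fun i hi => (?_ : β.rowLen (i + 1) = 1)]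
  · simp
  · have := mem_range.1 hi
    have h1 : 0 < β.rowLen (i + 1) := rowLen_pos_iff.2 (by omega)
    have := hs i
    omega

theorem hook_ne_bot {n r : ℕ} (h : r < n) : hook n r h ≠ ⊥ := by
  intro hb
  have := rowLen_hook h 0
  rw [hb, rowLen_bot, if_pos rfl] at this
  omega

/-- Having no 2×2 square forces all rows after the first to have length at most one; the dominoes
then give the leg and the size gives the arm. -/
theorem eq_hook_iff {β : YoungDiagram} {n r : ℕ} (h : r < n) (hne : β ≠ ⊥) :
    β = hook n r h ↔ ¬ ContainsSquare (skew β ⊥) ∧ β.card = n ∧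
      numVerticalDominoes (skew β ⊥) = r := by
  rw [not_containsSquare_iff]
  simp only [rowLen_bot, zero_add]
  constructor
  · rintro rfl
    have hs : ∀ i, (hook n r h).rowLen (i + 1) ≤ 1 := fun i => by
      rw [rowLen_hook, if_neg (by omega)]
      split_ifs <;> omega
    refine ⟨hs, ?_, ?_⟩
    · rw [card_of_rowLen_succ_le_one hs (colLen_hook h), rowLen_hook, if_pos rfl]
      omega
    · rw [numVerticalDominoes_skew_bot hs, colLen_hook]
      rfl
  · rintro ⟨hs, hc, hv⟩
    rw [numVerticalDominoes_skew_bot hs] at hv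
    have h0 : 0 < β.colLen 0 := by
      by_contra! hc
      exact hne (ext_rowLen fun i => by rw [rowLen_bot, rowLen_eq_zero_of_le hc (Nat.zero_le i)])
    have hl : β.colLen 0 = r + 1 := by omega
    rw [card_of_rowLen_succ_le_one hs hl] at hc
    refine ext_rowLen fun i => ?_
    rw [rowLen_hook]
    have hp := rowLen_pos_iff (β := β) (i := i)
    rcases i with _ | i
    · simp only [if_true]
      omega
    · have := hs i
      simp only [Nat.succ_ne_zero, if_false]
      split_ifs <;> omega

open Classical in
/-- The multiplicity of `β` in the product of `α` with the hook `(n - r, 1, …, 1)`. -/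
noncomputable def hookCoeff (α : YoungDiagram) (n r : ℕ) (β : YoungDiagram) : ℕ :=
  if α ≤ β ∧ ¬ ContainsSquare (skew β α) ∧ β.card = α.card + n ∧
      numVerticalDominoes (skew β α) ≤ r then
    (numComponents (skew β α) - 1).choose (r - numVerticalDominoes (skew β α)) else 0

/-- The outer variable plays x and the inner one y. The polynomial is homogeneous, which yields the
degree condition; `v ≤ r` guards the truncated subtraction. -/
theorem coeff_coeff_X_pow_mul {A : Type*} [CommRing A] (a v m e r : ℕ) :
    (((Polynomial.X : Polynomial (Polynomial A)) ^ a * Polynomial.C Polynomial.X ^ v *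
      (Polynomial.X + Polynomial.C Polynomial.X) ^ m).coeff e).coeff r =
        ((if a + v + m = e + r ∧ v ≤ r then m.choose (r - v) else 0 : ℕ) : A) := by
  rw [mul_assoc, mul_comm, ← Polynomial.C_pow, Polynomial.coeff_mul_X_pow']
  by_cases hae : a ≤ e
  · rw [if_pos hae, Polynomial.coeff_C_mul, Polynomial.coeff_X_add_C_pow, ← mul_assoc, ← pow_add,
      mul_comm, Polynomial.coeff_natCast_mul, Polynomial.coeff_X_pow]
    by_cases hm : e - a ≤ m
    · by_cases h : r = v + (m - (e - a))
      · rw [if_pos h, if_pos (by omega), mul_one, show r - v = m - (e - a) by omega,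
          Nat.choose_symm hm]
      · rw [if_neg h, if_neg (by omega)]
        simp
    · rw [Nat.choose_eq_zero_of_lt (by omega), Nat.cast_zero, zero_mul, if_neg (by omega),
        Nat.cast_zero]
  · rw [if_neg hae, Polynomial.coeff_zero]
    split_ifs with h
    · rw [Nat.choose_eq_zero_of_lt (by omega)]
      simp
    · simp

section Reduced

variable (A : Type*) [CommRing A]

open Classical in
/-- The weight of `β ≠ α` relative to `α`, divided by `x + y`. -/
noncomputable def reducedWeight (N : ℕ) (α β : YoungDiagram) : Polynomial (Polynomial A) :=
  if α ≤ β ∧ ¬ ContainsSquare (skew β α) ∧ β ≠ α then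
    Polynomial.X ^ (∑ i ∈ range N, (β.rowLen i - α.rowLen i - 1)) *
      Polynomial.C Polynomial.X ^ numVerticalDominoes (skew β α) *
        (Polynomial.X + Polynomial.C Polynomial.X) ^ (numComponents (skew β α) - 1) else 0

-- Only β = α contributes a weight without a factor x + y, since any other admissible shape has a
-- component.
open Classical in
theorem stripWeight_eq_add {N W : ℕ} {α β : YoungDiagram} (hα : α ∈ boxed N W)
    (hβ : β ∈ boxed N W) :
    stripWeight (Polynomial.X : Polynomial (Polynomial A)) (Polynomial.C Polynomial.X) N W α β =
      (if β = α then 1 else 0) +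
        (Polynomial.X + Polynomial.C Polynomial.X) * reducedWeight A N α β := by
  by_cases he : β = α
  · subst he
    have h1 : skew β β = ∅ := by simp [skew]
    rw [stripWeight_eq _ _ le_rfl (by simp [ContainsSquare, h1]) hβ]
    have h2 : numComponents ∅ = 0 := by simp [numComponents]
    simp [reducedWeight, h1, h2, numVerticalDominoes]
  · rw [if_neg he, zero_add, reducedWeight]
    split_ifs with h
    · have := numComponents_pos h.1 he
      rw [stripWeight_eq _ _ h.1 h.2.1 hβ, mul_left_comm, mul_pow_sub_one (by omega)]
    · rw [mul_zero]
      exact stripWeight_eq_zero _ _ hα hβ fun hc => h ⟨hc.1, hc.2, he⟩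

/-- By `sum_sub_one_add`, the reduced weight has degree |β/α| - 1, so extracting x^(n-1-r) y^r
selects |β/α| = n. -/
theorem coeff_coeff_reducedWeight {N W n r : ℕ} (hr : r < n) {α β : YoungDiagram}
    (hα : α ∈ boxed N W) (hβ : β ∈ boxed N W) :
    ((reducedWeight A N α β).coeff (n - 1 - r)).coeff r = (hookCoeff α n r β : A) := by
  rw [reducedWeight, hookCoeff]
  by_cases h : α ≤ β ∧ ¬ ContainsSquare (skew β α)
  · by_cases he : β = α
    · subst he
      rw [if_neg (by tauto), if_neg (by omega)]
      simp
    · have hk := numComponents_pos h.1 he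
      have hc := sum_sub_one_add h.1 (not_containsSquare_iff.1 h.2) (mem_boxed.1 hα).1
        (mem_boxed.1 hβ).1
      rw [if_pos ⟨h.1, h.2, he⟩, coeff_coeff_X_pow_mul]
      simp only [h, not_false_eq_true, true_and]
      congr 1
      refine if_congr (and_congr_left' ?_) rfl rfl
      omega
  · rw [if_neg (by tauto), if_neg (by tauto)]
    simp

end Reduced

/-! ### Passage to polynomials and extraction of one hook. -/

theorem map_stripWeight {R S : Type*} [CommRing R] [CommRing S] (q : R →+* S) (x y : R) (N W : ℕ)
    (α β : YoungDiagram) :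
    q (stripWeight x y N W α β) = stripWeight (q x) (q y) N W α β := by
  simp only [stripWeight, stripEntry, map_prod, apply_ite q, map_mul, map_pow, map_add, map_one,
    map_zero]

/-- In the quotient by `x ^ D` the nilpotent identity applies. -/
theorem pow_dvd_sum_stripWeight {R : Type*} [CommRing R] (x y : R) {N W D : ℕ} (z : Fin N → R)
    {α : YoungDiagram} (hW : α.rowLen 0 + D ≤ W) :
    x ^ D ∣ alternantAt z ⊥ * ∑ β ∈ boxed N W, stripWeight x y N W α β * alternantAt z β -
      alternantAt z α * ∑ β ∈ boxed N W, stripWeight x y N W ⊥ β * alternantAt z β := by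
  have key : ∀ {S : Type _} [CommRing S] (q : R →+* S), q x ^ D = 0 →
      q (alternantAt z ⊥ * ∑ β ∈ boxed N W, stripWeight x y N W α β * alternantAt z β) =
        q (alternantAt z α * ∑ β ∈ boxed N W, stripWeight x y N W ⊥ β * alternantAt z β) := by
    intro S _ q hx
    simp only [map_mul, map_sum, map_stripWeight, map_alternantAt]
    exact alternantAt_bot_mul_sum_stripWeight _ _ _ hx hW
  rw [← Ideal.mem_span_singleton, ← Ideal.Quotient.eq]
  refine key (Ideal.Quotient.mk (Ideal.span {x ^ D})) ?_
  rw [← map_pow]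
  exact Ideal.Quotient.eq_zero_iff_mem.2 (Ideal.mem_span_singleton_self _)

theorem bot_mem_boxed (N W : ℕ) : ⊥ ∈ boxed N W :=
  mem_boxed.2 ⟨by rw [colLen_zero_le_iff, rowLen_bot], by simp [rowLen_bot]⟩

theorem alternantAt_bot_mul_sum_hookCoeff {A : Type*} [CommRing A] [IsDomain A] {N W n r : ℕ}
    (hr : r < n) (z : Fin N → A) {α : YoungDiagram} (hα : α.colLen 0 ≤ N)
    (hW : α.rowLen 0 + n ≤ W) :
    alternantAt z ⊥ * ∑ β ∈ boxed N W, (hookCoeff α n r β : A) * alternantAt z β =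
      alternantAt z α * ∑ β ∈ boxed N W, (hookCoeff ⊥ n r β : A) * alternantAt z β := by
  classical
  have hαm : α ∈ boxed N W := mem_boxed.2 ⟨hα, by omega⟩
  have hsum : ∀ μ ∈ boxed N W, ∑ β ∈ boxed N W,
      stripWeight (Polynomial.X : Polynomial (Polynomial A)) (Polynomial.C Polynomial.X) N W μ β *
        Polynomial.C (Polynomial.C (alternantAt z β)) =
      Polynomial.C (Polynomial.C (alternantAt z μ)) +
        (Polynomial.X + Polynomial.C Polynomial.X) * ∑ β ∈ boxed N W,
          reducedWeight A N μ β * Polynomial.C (Polynomial.C (alternantAt z β)) := by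
    intro μ hμ
    rw [sum_congr rfl fun β hβ => by rw [stripWeight_eq_add A hμ hβ, add_mul, mul_assoc],
      sum_add_distrib, ← mul_sum]
    simp [hμ]
  have h := pow_dvd_sum_stripWeight (Polynomial.X : Polynomial (Polynomial A))
    (Polynomial.C Polynomial.X) (fun i => Polynomial.C (Polynomial.C (z i))) hW
  simp only [← map_alternantAt] at h
  rw [hsum α hαm, hsum ⊥ (bot_mem_boxed N W)] at h
  set P := ∑ β ∈ boxed N W, reducedWeight A N α β * Polynomial.C (Polynomial.C (alternantAt z β))
  set Q := ∑ β ∈ boxed N W, reducedWeight A N ⊥ β * Polynomial.C (Polynomial.C (alternantAt z β))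
  -- The terms β = μ contribute the same product of alternants to both sides and cancel.
  have h' : (Polynomial.X : Polynomial (Polynomial A)) ^ n ∣
      (Polynomial.X + Polynomial.C Polynomial.X) *
        (Polynomial.C (Polynomial.C (alternantAt z ⊥)) * P -
          Polynomial.C (Polynomial.C (alternantAt z α)) * Q) := by
    convert h using 1
    ring
  -- X is prime and does not divide x + y, so x^n divides the other factor, whose coefficients below
  -- degree n therefore vanish.
  have hX : ¬ (Polynomial.X : Polynomial (Polynomial A)) ∣
      Polynomial.X + Polynomial.C Polynomial.X := by
    rw [Polynomial.X_dvd_iff]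
    simp
  have hd := Polynomial.X_pow_dvd_iff.1
    (Polynomial.prime_X.pow_dvd_of_dvd_mul_left _ hX h') (n - 1 - r) (by omega)
  have hcoeff : ∀ μ ∈ boxed N W, ((∑ β ∈ boxed N W, reducedWeight A N μ β *
      Polynomial.C (Polynomial.C (alternantAt z β))).coeff (n - 1 - r)).coeff r =
        ∑ β ∈ boxed N W, (hookCoeff μ n r β : A) * alternantAt z β := by
    intro μ hμ
    rw [Polynomial.finsetSum_coeff, Polynomial.finsetSum_coeff]
    refine sum_congr rfl fun β hβ => ?_
    rw [Polynomial.coeff_mul_C, Polynomial.coeff_mul_C, coeff_coeff_reducedWeight A hr hμ hβ]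
  have hd' := congrArg (fun p => Polynomial.coeff p r) hd
  simp only [Polynomial.coeff_sub, Polynomial.coeff_C_mul, Polynomial.coeff_zero] at hd'
  rw [hcoeff α hαm, hcoeff ⊥ (bot_mem_boxed N W)] at hd'
  exact sub_eq_zero.1 hd'

/-- A nonempty diagram is connected, so the binomial is (0 over r - v), which forces v = r. -/
theorem hookCoeff_bot {n r : ℕ} (hr : r < n) (β : YoungDiagram) [Decidable (β = hook n r hr)] :
    hookCoeff ⊥ n r β = if β = hook n r hr then 1 else 0 := by
  by_cases hne : β = ⊥
  · subst hne
    rw [hookCoeff, if_neg (by omega), if_neg (hook_ne_bot hr).symm]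
  · have hb : (⊥ : YoungDiagram).card = 0 := rfl
    have hk := numComponents_skew_bot hne
    rw [hookCoeff, hk, hb, zero_add]
    by_cases hh : β = hook n r hr
    · obtain ⟨h1, h2, h3⟩ := (eq_hook_iff hr hne).1 hh
      rw [if_pos ⟨bot_le, h1, h2, h3.le⟩, if_pos hh, h3]
      simp
    · rw [if_neg hh]
      split_ifs with h
      · refine Nat.choose_eq_zero_of_lt ?_
        have : numVerticalDominoes (skew β ⊥) ≠ r := fun hv =>
          hh ((eq_hook_iff hr hne).2 ⟨h.2.1, h.2.2.1, hv⟩)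
        omega
      · rfl

/-! ### The Schur expansion. -/

theorem rowLen_le_card (β : YoungDiagram) (i : ℕ) : β.rowLen i ≤ β.card := by
  rw [β.rowLen_eq_card]
  exact card_filter_le _ _

theorem colLen_le_card (β : YoungDiagram) (j : ℕ) : β.colLen j ≤ β.card := by
  rw [β.colLen_eq_card]
  exact card_filter_le _ _

theorem le_and_card_of_hookCoeff_ne_zero {α β : YoungDiagram} {n r : ℕ}
    (h : hookCoeff α n r β ≠ 0) : α ≤ β ∧ β.card = α.card + n := by
  rw [hookCoeff] at h
  split_ifs at h with hc
  · exact ⟨hc.1, hc.2.2.1⟩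
  · exact absurd rfl h

/-- The expansion of the product of `α` with the hook `(n - r, 1, …, 1)`. -/
noncomputable def hookExpansion (α : YoungDiagram) (n r : ℕ) : YoungDiagram →₀ ℕ :=
  Finsupp.onFinset (boxed (α.card + n) (α.card + n)) (hookCoeff α n r) fun β hβ => by
    rw [← (le_and_card_of_hookCoeff_ne_zero hβ).2]
    exact mem_boxed.2 ⟨colLen_le_card β 0, rowLen_le_card β 0⟩

theorem hookExpansion_apply (α : YoungDiagram) (n r : ℕ) (β : YoungDiagram) :
    hookExpansion α n r β = hookCoeff α n r β := rfl

theorem algebraMap_alternant_bot_ne_zero (N : ℕ) :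
    algebraMap (MvPolynomial (Fin N) ℤ) (FractionRing (MvPolynomial (Fin N) ℤ))
      (alternant N ⊥) ≠ 0 := by
  intro h
  rw [map_eq_zero_iff _ (IsFractionRing.injective _ _)] at h
  have hb : (⊥ : YoungDiagram).colLen 0 ≤ N := (mem_boxed.1 (bot_mem_boxed N 0)).1
  have := coeff_alternant N ⊥ ⊥ hb hb
  rw [h] at this
  simp at this

theorem isSchurExpansion_hookExpansion {n r : ℕ} (hr : r < n) (α : YoungDiagram) :
    IsSchurExpansion α (hook n r hr) (hookExpansion α n r) := by
  classical
  intro N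
  by_cases hα : α.colLen 0 ≤ N
  · set W := α.card + n with hW
    set φ := algebraMap (MvPolynomial (Fin N) ℤ) (FractionRing (MvPolynomial (Fin N) ℤ))
    have hne : φ (alternant N ⊥) ≠ 0 := algebraMap_alternant_bot_ne_zero N
    have hschurα : schur N α = φ (alternant N α) / φ (alternant N ⊥) := if_pos hα
    have hschur : ∀ β ∈ boxed N W, schur N β = φ (alternant N β) / φ (alternant N ⊥) :=
      fun β hβ => if_pos (mem_boxed.1 hβ).1
    have key := alternantAt_bot_mul_sum_hookCoeff hr
      (fun i : Fin N => (MvPolynomial.X i : MvPolynomial (Fin N) ℤ)) (W := W) hα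
      (by have := rowLen_le_card α 0; omega)
    simp only [alternantAt_X] at key
    have hhook : φ (∑ β ∈ boxed N W, (hookCoeff ⊥ n r β : MvPolynomial (Fin N) ℤ) *
        alternant N β) = schur N (hook n r hr) * φ (alternant N ⊥) := by
      simp only [hookCoeff_bot hr, Nat.cast_ite, Nat.cast_one, Nat.cast_zero, ite_mul, one_mul,
        zero_mul, sum_ite_eq']
      by_cases hh : hook n r hr ∈ boxed N W
      · rw [if_pos hh, hschur _ hh, div_mul_cancel₀ _ hne]
      -- The arm always fits in `W` columns, so the hook can only fail by having too many rows, and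
      -- then its Schur function is zero.
      · have : ¬ (hook n r hr).colLen 0 ≤ N := fun hc => hh (mem_boxed.2 ⟨hc, by
          rw [rowLen_hook, if_pos rfl]
          omega⟩)
        rw [if_neg hh, schur, if_neg this, map_zero, zero_mul]
    have hexp : ∑ γ ∈ (hookExpansion α n r).support,
        (hookExpansion α n r γ : FractionRing (MvPolynomial (Fin N) ℤ)) * schur N γ =
          ∑ β ∈ boxed N W, (hookCoeff α n r β : FractionRing (MvPolynomial (Fin N) ℤ)) *
            schur N β := by
      simp only [hookExpansion_apply]
      -- Both sums reduce to the intersection: supported diagrams outside the box have more than `N`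
      -- rows, and boxed ones outside the support have coefficient zero.
      refine (sum_subset_zero_on_sdiff (inter_subset_left (s₂ := boxed N W)) (fun β hβ => ?_)
        fun _ _ => rfl).symm.trans
          (sum_subset_zero_on_sdiff inter_subset_right (fun β hβ => ?_) fun _ _ => rfl)
      · obtain ⟨h1, h2⟩ := mem_sdiff.1 hβ
        have hc := (le_and_card_of_hookCoeff_ne_zero (Finsupp.mem_support_iff.1 h1)).2
        have : ¬ β.colLen 0 ≤ N := fun hN => h2 (mem_inter.2 ⟨h1, mem_boxed.2 ⟨hN, by
          have := rowLen_le_card β 0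
          omega⟩⟩)
        rw [schur, if_neg this, mul_zero]
      · obtain ⟨h1, h2⟩ := mem_sdiff.1 hβ
        have : hookCoeff α n r β = 0 := by
          by_contra h0
          exact h2 (mem_inter.2 ⟨Finsupp.mem_support_iff.2 h0, h1⟩)
        rw [this, Nat.cast_zero, zero_mul]
    have hsum : ∑ β ∈ boxed N W, (hookCoeff α n r β : FractionRing (MvPolynomial (Fin N) ℤ)) *
        schur N β = φ (∑ β ∈ boxed N W, (hookCoeff α n r β : MvPolynomial (Fin N) ℤ) *
          alternant N β) / φ (alternant N ⊥) := by
      rw [map_sum, sum_div]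
      refine sum_congr rfl fun β hβ => ?_
      rw [hschur β hβ, map_mul, map_natCast, mul_div_assoc]
    have key' := congrArg φ key
    rw [map_mul, map_mul, hhook] at key'
    rw [hexp, hsum, hschurα, eq_div_iff hne]
    refine mul_left_cancel₀ hne ?_
    rw [key']
    field_simp
  -- With fewer variables than rows of α, every γ in the support contains α, so both sides vanish.
  · rw [schur, if_neg hα, zero_mul]
    refine (sum_eq_zero fun γ hγ => ?_).symm
    have hle := (le_and_card_of_hookCoeff_ne_zero (Finsupp.mem_support_iff.1 hγ)).1
    have : ¬ γ.colLen 0 ≤ N := by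
      rw [colLen_zero_le_iff] at hα ⊢
      have := le_iff_rowLen.1 hle N
      omega
    rw [schur, if_neg this, mul_zero]

theorem lrCoeff_hook {n r : ℕ} (hr : r < n) (α β : YoungDiagram) :
    lrCoeff α (hook n r hr) β = hookCoeff α n r β := by
  have h : ∃ c, IsSchurExpansion α (hook n r hr) c := ⟨_, isSchurExpansion_hookExpansion hr α⟩
  rw [lrCoeff, dif_pos h, h.choose_spec.unique (isSchurExpansion_hookExpansion hr α),
    hookExpansion_apply]

end SchurHook

theorem mainTheorem6 (α β : YoungDiagram) (n r : ℕ) (hr : r < n) :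
    (SchurHook.lrCoeff α (SchurHook.hook n r hr) β ≠ 0 ↔
      α ≤ β ∧ β.card = α.card + n ∧
      ¬ SchurHook.ContainsSquare (SchurHook.skew β α) ∧
      SchurHook.numVerticalDominoes (SchurHook.skew β α) ≤ r ∧
      r ≤ SchurHook.numVerticalDominoes (SchurHook.skew β α) +
        SchurHook.numComponents (SchurHook.skew β α) - 1) ∧
    (SchurHook.lrCoeff α (SchurHook.hook n r hr) β ≠ 0 →
      SchurHook.lrCoeff α (SchurHook.hook n r hr) β =
        (SchurHook.numComponents (SchurHook.skew β α) - 1).choose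
          (r - SchurHook.numVerticalDominoes (SchurHook.skew β α))) := by
  rw [SchurHook.lrCoeff_hook, SchurHook.hookCoeff]
  split_ifs with h
  · obtain ⟨h1, h2, h3, h4⟩ := h
    -- Since n > 0, β ≠ α; thus k ≥ 1 and the truncated `k - 1` is a true subtraction.
    have hk := SchurHook.numComponents_pos h1 (by rintro rfl; omega)
    refine ⟨?_, fun _ => rfl⟩
    rw [Nat.choose_ne_zero_iff]
    constructor
    · intro h5
      exact ⟨h1, h3, h2, h4, by omega⟩
    · rintro ⟨-, -, -, -, h5⟩
      omega
  · refine ⟨⟨fun h0 => absurd rfl h0, ?_⟩, fun h0 => absurd rfl h0⟩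
    rintro ⟨h1, h2, h3, h4, -⟩
    exact absurd ⟨h1, h3, h2, h4⟩ h
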